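/- Let $\mathbf{k}$ be an algebraically closed field and let $R=\mathbf{k}[x_0,x_1,y_0,y_1]$ be the coordinate ring of $\mathbb{P}^1\times\mathbb{P}^1$, bigraded by $\deg x_i=(1,0)$ and $\deg y_i=(0,1)$. For a point $P=[a_0:a_1]\times[b_0:b_1]$ put $\wp_P=(a_1x_0-a_0x_1,\ b_1y_0-b_0y_1)\subseteq R$. Let $Z=\{(P_1;m_1),\dots,(P_s;m_s)\}$ be a fat point scheme in $\mathbb{P}^1\times\mathbb{P}^1$, where $s\ge 1$, the points $P_1,\dots,P_s$ are distinct and $m_1,\dots,m_s$ are positive integers; its defining ideal is $I_Z=\bigcap_{l=1}^{s}\wp_{P_l}^{m_l}$. If $Z$ is arithmetically Cohen-Macaulay, i.e. if the ring $R/I_Z$ is Cohen-Macaulay, then there exist bihomogeneous forms $L_1,L_2\in R$ with $\deg L_1=(1,0)$ and $\deg L_2=(0,1)$ whose images $\overline{L}_1,\overline{L}_2$ form a regular sequence in $R/I_Z$, i.e. $\overline{L}_1$ is a nonzerodivisor on $R/I_Z$, $\overline{L}_2$ is a nonzerodivisor on $R/(I_Z,L_1)$, and $(I_Z,L_1,L_2)\ne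 R$. -/

import Mathlib

open scoped LinearAlgebra.Projectivization

noncomputable section

/-- The coordinate ring `k[x₀, x₁, y₀, y₁]` of `ℙ¹ × ℙ¹`: the variable `Sum.inl i` is `xᵢ`, the
variable `Sum.inr i` is `yᵢ`. -/
abbrev BiRing (k : Type*) [Field k] : Type _ := MvPolynomial (Fin 2 ⊕ Fin 2) k

/-- The bidegrees of the variables: `deg xᵢ = (1, 0)` and `deg yᵢ = (0, 1)`. -/
def biWeight : Fin 2 ⊕ Fin 2 → ℕ × ℕ := Sum.elim (fun _ => (1, 0)) (fun _ => (0, 1))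

/-- `F` is a bihomogeneous form of degree `d` (as usual, `0` is a form of every degree). -/
def IsBiform {k : Type*} [Field k] (F : BiRing k) (d : ℕ × ℕ) : Prop :=
  MvPolynomial.IsWeightedHomogeneous biWeight F d

/-- The projective line over `k`. -/
abbrev ProjLine (k : Type*) [Field k] : Type _ := ℙ k (Fin 2 → k)

/-- The ideal `(a₁ x₀ - a₀ x₁, b₁ y₀ - b₀ y₁)` attached to two vectors `a`, `b`. -/
def vecIdeal {k : Type*} [Field k] (a b : Fin 2 → k) : Ideal (BiRing k) :=
  Ideal.span
    {MvPolynomial.C (a 1) * MvPolynomial.X (Sum.inl 0)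
        - MvPolynomial.C (a 0) * MvPolynomial.X (Sum.inl 1),
      MvPolynomial.C (b 1) * MvPolynomial.X (Sum.inr 0)
        - MvPolynomial.C (b 0) * MvPolynomial.X (Sum.inr 1)}

theorem vecIdeal_smul_le {k : Type*} [Field k] (a b : Fin 2 → k) (s t : kˣ) :
    vecIdeal (s • a) (t • b) ≤ vecIdeal a b := by
  refine Ideal.span_le.2 ?_
  rintro F (rfl | rfl)
  · have h : MvPolynomial.C ((s • a) 1) * MvPolynomial.X (Sum.inl 0)
        - MvPolynomial.C ((s • a) 0) * MvPolynomial.X (Sum.inl 1)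
        = (MvPolynomial.C (s : k) : BiRing k) * (MvPolynomial.C (a 1) * MvPolynomial.X (Sum.inl 0)
        - MvPolynomial.C (a 0) * MvPolynomial.X (Sum.inl 1)) := by
      simp only [Pi.smul_apply, Units.smul_def, smul_eq_mul, map_mul]; ring
    rw [h]
    exact Ideal.mul_mem_left _ _ (Ideal.subset_span (Set.mem_insert _ _))
  · have h : MvPolynomial.C ((t • b) 1) * MvPolynomial.X (Sum.inr 0)
        - MvPolynomial.C ((t • b) 0) * MvPolynomial.X (Sum.inr 1)
        = (MvPolynomial.C (t : k) : BiRing k) * (MvPolynomial.C (b 1) * MvPolynomial.X (Sum.inr 0)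
        - MvPolynomial.C (b 0) * MvPolynomial.X (Sum.inr 1)) := by
      simp only [Pi.smul_apply, Units.smul_def, smul_eq_mul, map_mul]; ring
    rw [h]
    exact Ideal.mul_mem_left _ _ (Ideal.subset_span (Set.mem_insert_of_mem _ rfl))

/-- The bihomogeneous prime ideal of the point `P = [a₀ : a₁] × [b₀ : b₁]`. -/
def pointIdeal {k : Type*} [Field k] (P : ProjLine k × ProjLine k) : Ideal (BiRing k) :=
  vecIdeal P.1.rep P.2.rep

/-- `pointIdeal` does not depend on the choice of homogeneous coordinates. -/
theorem pointIdeal_mk {k : Type*} [Field k] (a b : Fin 2 → k) (ha : a ≠ 0) (hb : b ≠ 0) :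
    pointIdeal (Projectivization.mk k a ha, Projectivization.mk k b hb) = vecIdeal a b := by
  obtain ⟨s, hs⟩ := Projectivization.exists_smul_eq_mk_rep k a ha
  obtain ⟨t, ht⟩ := Projectivization.exists_smul_eq_mk_rep k b hb
  unfold pointIdeal
  rw [← hs, ← ht]
  refine le_antisymm (vecIdeal_smul_le a b s t) ?_
  simpa using vecIdeal_smul_le (s • a) (t • b) s⁻¹ t⁻¹

/-- The data of a (possibly empty) fat point scheme in `ℙ¹ × ℙ¹`: each point gets a multiplicity,
and only finitely many multiplicities are nonzero. -/
abbrev FatPoints (k : Type*) [Field k] : Type _ := (ProjLine k × ProjLine k) →₀ ℕ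

/-- The defining ideal `I_Z`: the intersection of the powers `℘_P ^ m_P` over the support of `Z`. -/
def FatPoints.ideal {k : Type*} [Field k] (Z : FatPoints k) : Ideal (BiRing k) :=
  ⨅ P ∈ Z.support, pointIdeal P ^ Z P

/-- The depth of a local ring: the supremum of the lengths of the regular sequences in its
maximal ideal. -/
def localDepth (A : Type*) [CommRing A] [IsLocalRing A] : ℕ∞ :=
  ⨆ rs ∈ {rs : List A | (∀ r ∈ rs, r ∈ IsLocalRing.maximalIdeal A) ∧
    RingTheory.Sequence.IsRegular A rs}, (rs.length : ℕ∞)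

/-- A Cohen-Macaulay ring: a Noetherian ring whose localizations at maximal ideals all have depth
equal to their Krull dimension. -/
def IsCMRing (A : Type*) [CommRing A] : Prop :=
  IsNoetherianRing A ∧ ∀ (m : Ideal A) [m.IsMaximal],
    (localDepth (Localization.AtPrime m) : WithBot ℕ∞) = ringKrullDim (Localization.AtPrime m)

/-- `Z` is arithmetically Cohen-Macaulay. -/
def FatPoints.IsACM {k : Type*} [Field k] (Z : FatPoints k) : Prop :=
  IsCMRing (BiRing k ⧸ Z.ideal)

end

open RingTheory.Sequence
open scoped Pointwise

/-! ### Depth two and socles modulo a nonzerodivisor -/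

section Depth

variable {A : Type*} [CommRing A]

/-! Since `k` is infinite, L₁ and L₂ can be chosen to vanish at no point of Z. In coordinates where
℘_P is generated by two variables and L₁ is a third, L₁ is visibly a nonzerodivisor modulo each
℘_P^m, hence modulo I_Z. A prime containing I_Z, L₁ and L₂ contains some ℘_P, hence all the
variables: it contains the vertex ideal m. The cone over a point of Z gives m height at least 2, so
Cohen-Macaulayness gives depth at least 2 at m. Then no nonzero class modulo L₁ is killed by m
(`mem_span_of_maximal_mul_mem`). If L₂F ∈ (L₁), the colon ideal (L₁) : F contains L₁ and L₂, so it
contains a power of m, and removing factors of m one at a time gives F ∈ (L₁). -/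

theorem isWeaklyRegular_pair_iff (a b : A) (l : List A) :
    IsWeaklyRegular A (a :: b :: l) ↔
      (∀ x, a * x = 0 → x = 0) ∧ (∀ x, b * x ∈ Ideal.span {a} → x ∈ Ideal.span {a}) ∧
        IsWeaklyRegular (QuotSMulTop b (QuotSMulTop a A)) l := by
  have h : a • (⊤ : Submodule A A) = Ideal.span {a} := by
    rw [← Submodule.ideal_span_singleton_smul, smul_eq_mul, Ideal.mul_top]
  rw [isWeaklyRegular_cons_iff, isWeaklyRegular_cons_iff, isSMulRegular_iff_right_eq_zero_of_smul,
    isSMulRegular_quotient_iff_mem_of_smul_mem]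
  simp only [h, smul_eq_mul]

/-- Triviality of the socle modulo one nonzerodivisor passes to any other nonzerodivisor. -/
theorem mem_span_of_mul_mem_span {f g L u : A} (hf : ∀ x, f * x = 0 → x = 0)
    (hg : ∀ x, g * x ∈ Ideal.span {f} → x ∈ Ideal.span {f}) (hL : ∀ x, L * x = 0 → x = 0)
    (hfu : f * u ∈ Ideal.span {L}) (hgu : g * u ∈ Ideal.span {L}) : u ∈ Ideal.span {L} := by
  obtain ⟨v, hv⟩ := Ideal.mem_span_singleton'.1 hfu
  obtain ⟨w, hw⟩ := Ideal.mem_span_singleton'.1 hgu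
  -- Both sides times `L` equal `f * g * u`. Regularity of `g` modulo `f` then makes `v` a multiple
  -- of `f`.
  have h : g * v = w * f := by
    rw [← sub_eq_zero]
    apply hL
    linear_combination g * hv - f * hw
  obtain ⟨v', rfl⟩ := Ideal.mem_span_singleton'.1 (hg v (h ▸ Ideal.mul_mem_left _ _
    (Ideal.mem_span_singleton_self f)))
  refine Ideal.mem_span_singleton'.2 ⟨v', ?_⟩
  rw [← sub_eq_zero]
  apply hf
  linear_combination hv

theorem exists_regular_pair_of_two_le_localDepth [IsLocalRing A] (h : 2 ≤ localDepth A) :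
    ∃ f ∈ IsLocalRing.maximalIdeal A, ∃ g ∈ IsLocalRing.maximalIdeal A,
      (∀ x, f * x = 0 → x = 0) ∧ ∀ x, g * x ∈ Ideal.span {f} → x ∈ Ideal.span {f} := by
  have h1 : (1 : ℕ∞) < localDepth A := lt_of_lt_of_le (by norm_num) h
  simp only [localDepth, lt_iSup_iff] at h1
  obtain ⟨rs, ⟨hm, hreg⟩, hlen⟩ := h1
  match rs, hm, hreg, hlen with
  | [], _, _, hlen => simp at hlen
  | [_], _, _, hlen => simp at hlen
  | f :: g :: l, hm, hreg, _ =>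
    have := (isWeaklyRegular_pair_iff f g l).1 hreg.toIsWeaklyRegular
    exact ⟨f, hm f (by simp), g, hm g (by simp), this.1, this.2.1⟩

/-- Depth two settles this in the localization at `m`. The denominator `s` to be cleared is a unit
modulo `m`, and `m` already multiplies `u` into `(L)`. -/
theorem mem_span_of_maximal_mul_mem (m : Ideal A) [m.IsMaximal]
    (hd : 2 ≤ localDepth (Localization.AtPrime m)) {L u : A} (hL : ∀ x, L * x = 0 → x = 0)
    (hu : ∀ r ∈ m, r * u ∈ Ideal.span {L}) : u ∈ Ideal.span {L} := by
  let S := Localization.AtPrime m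
  obtain ⟨f, hfm, g, hgm, hf, hg⟩ := exists_regular_pair_of_two_le_localDepth hd
  have hLS : ∀ x : S, algebraMap A S L * x = 0 → x = 0 := by
    intro x hx
    obtain ⟨⟨a, s⟩, rfl⟩ := IsLocalization.mk'_surjective m.primeCompl x
    rw [← IsLocalization.mk'_one (M := m.primeCompl) S L, ← IsLocalization.mk'_mul,
      IsLocalization.mk'_eq_zero_iff] at hx
    obtain ⟨t, ht⟩ := hx
    refine (IsLocalization.mk'_eq_zero_iff _ _).2 ⟨t, hL _ ?_⟩
    linear_combination ht
  have hmax : ∀ r ∈ IsLocalRing.maximalIdeal S,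
      r * algebraMap A S u ∈ Ideal.span {algebraMap A S L} := by
    have : m.map (algebraMap A S) ≤
        (Submodule.comap (LinearMap.mulRight S (algebraMap A S u)) (Ideal.span {algebraMap A S L}) :
          Ideal S) := by
      refine Ideal.map_le_iff_le_comap.2 fun r hr => ?_
      change algebraMap A S r * algebraMap A S u ∈ Ideal.span {algebraMap A S L}
      rw [← map_mul, ← Set.image_singleton, ← Ideal.map_span]
      exact Ideal.mem_map_of_mem _ (hu r hr)
    rw [Localization.AtPrime.map_eq_maximalIdeal] at this
    exact fun r hr => this hr
  have key := mem_span_of_mul_mem_span hf hg hLS (hmax f hfm) (hmax g hgm)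
  rw [← Set.image_singleton, ← Ideal.map_span,
    IsLocalization.algebraMap_mem_map_algebraMap_iff m.primeCompl] at key
  obtain ⟨s, hs, hsu⟩ := key
  obtain ⟨a, r, hr, h1⟩ := Ideal.IsMaximal.exists_inv (I := m) inferInstance hs
  have : u = a * (s * u) + r * u := by linear_combination -u * h1
  rw [this]
  exact add_mem (Ideal.mul_mem_left _ _ hsu) (hu r hr)

/-- If `L₁` is a nonzerodivisor and `A` has depth at least two at `m`, then every `L₂` such that
`(L₁, L₂)` is `m`-primary or the unit ideal is a nonzerodivisor modulo `L₁`. -/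
theorem mem_span_of_mul_mem_span_of_primes (m : Ideal A) [m.IsMaximal] (hfg : m.FG)
    (hd : 2 ≤ localDepth (Localization.AtPrime m)) {L₁ L₂ F : A}
    (hL : ∀ x, L₁ * x = 0 → x = 0)
    (hp : ∀ p : Ideal A, p.IsPrime → L₁ ∈ p → L₂ ∈ p → m ≤ p)
    (hF : L₂ * F ∈ Ideal.span {L₁}) : F ∈ Ideal.span {L₁} := by
  -- The colon ideal `(L₁) : F`.
  let K : Ideal A := Submodule.comap (LinearMap.mulRight A F) (Ideal.span {L₁})
  have hK : m ≤ K.radical := by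
    rw [Ideal.radical_eq_sInf]
    refine le_sInf fun p ⟨hKp, hpp⟩ => hp p hpp (hKp ?_) (hKp hF)
    exact Ideal.mul_mem_right _ _ (Ideal.mem_span_singleton_self L₁)
  obtain ⟨n, hn⟩ := Ideal.exists_pow_le_of_le_radical_of_fg hK hfg
  have hn' : ∀ r ∈ m ^ n, r * F ∈ Ideal.span {L₁} := fun r hr => hn hr
  clear hn
  induction n with
  | zero => simpa using hn' 1 (by simp)
  | succ n ih =>
    refine ih fun r hr => mem_span_of_maximal_mul_mem m hd hL fun t ht => ?_
    rw [← mul_assoc]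
    exact hn' _ (pow_succ' m n ▸ Ideal.mul_mem_mul ht hr)

end Depth

/-! ### Powers of an ideal generated by two variables -/

section Variables

open MvPolynomial

variable {σ k : Type*} [CommRing k]

theorem mem_span_X_pair_pow_iff {i j : σ} (hij : i ≠ j) (n : ℕ) (F : MvPolynomial σ k) :
    F ∈ (Ideal.span {X i, X j} : Ideal (MvPolynomial σ k)) ^ n ↔
      ∀ d, d i + d j < n → coeff d F = 0 := by
  classical
  constructor
  · induction n generalizing F with
    | zero => simp
    | succ n ih =>
      intro hF
      rw [pow_succ'] at hF
      refine Submodule.mul_induction_on hF (fun r hr s hs d hd => ?_) fun x y hx hy d hd => ?_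
      · obtain ⟨a, b, rfl⟩ := Ideal.mem_span_pair.1 hr
        have hcoeff (c : MvPolynomial σ k) (l : σ) (hl : l = i ∨ l = j) :
            coeff d (c * s * X l) = 0 := by
          rw [coeff_mul_X']
          split_ifs with h
          · refine ih _ (Ideal.mul_mem_left _ c hs) _ ?_
            have := Finsupp.mem_support_iff.1 h
            rcases hl with rfl | rfl
            · simp [hij.symm]; omega
            · simp [hij]; omega
          · rfl
        rw [show (a * X i + b * X j) * s = a * s * X i + b * s * X j by ring, coeff_add,
          hcoeff a i (Or.inl rfl), hcoeff b j (Or.inr rfl), add_zero]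
      · rw [coeff_add, hx d hd, hy d hd, add_zero]
  · intro h
    rw [F.as_sum]
    refine Ideal.sum_mem _ fun d hd => ?_
    have hn : n ≤ d i + d j := by
      by_contra hlt
      exact mem_support_iff.1 hd (h d (not_le.1 hlt))
    have hle : Finsupp.single i (d i) + Finsupp.single j (d j) ≤ d := by
      intro l
      by_cases hi : l = i
      · subst hi; simp [hij]
      · by_cases hj : l = j
        · subst hj; simp [hij.symm]
        · simp [Ne.symm hi, Ne.symm hj]
    obtain ⟨e, he⟩ := exists_add_of_le hle
    have hmon : monomial d (coeff d F) = monomial e (coeff d F) * (X i ^ d i * X j ^ d j) := by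
      rw [X_pow_eq_monomial, X_pow_eq_monomial, monomial_mul, monomial_mul, mul_one, mul_one,
        add_comm e, ← he]
    rw [hmon]
    refine Ideal.mul_mem_left _ _ (Ideal.pow_le_pow_right hn ?_)
    rw [pow_add]
    exact Ideal.mul_mem_mul (Ideal.pow_mem_pow (Ideal.subset_span (by simp)) _)
      (Ideal.pow_mem_pow (Ideal.subset_span (by simp)) _)

/-- Multiplication by a third variable shifts exponents without changing `d i + d j`. -/
theorem mem_span_X_pair_pow_of_X_mul_mem {i j l : σ} (hij : i ≠ j) (hi : l ≠ i) (hj : l ≠ j)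
    {n : ℕ} {F : MvPolynomial σ k}
    (h : X l * F ∈ (Ideal.span {X i, X j} : Ideal (MvPolynomial σ k)) ^ n) :
    F ∈ (Ideal.span {X i, X j} : Ideal (MvPolynomial σ k)) ^ n := by
  classical
  rw [mem_span_X_pair_pow_iff hij] at h ⊢
  intro d hd
  rw [← coeff_X_mul d l F]
  exact h _ (by simpa [hi, hj] using hd)

end Variables

/-! ### Linear forms and changes of coordinates -/

section PointIdeal

open MvPolynomial

variable {k : Type*} [Field k]

/-- The linear form `a₁ z₀ - a₀ z₁` in the pair of variables `z = x` or `z = y`. -/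
noncomputable def linForm (ι : Fin 2 → Fin 2 ⊕ Fin 2) (a : Fin 2 → k) : BiRing k :=
  C (a 1) * X (ι 0) - C (a 0) * X (ι 1)

/-- Cramer's rule: two independent linear forms span both variables. -/
theorem X_mem_of_linForm_mem {ι : Fin 2 → Fin 2 ⊕ Fin 2} {a c : Fin 2 → k}
    (h : a 0 * c 1 - a 1 * c 0 ≠ 0) {p : Ideal (BiRing k)} (ha : linForm ι a ∈ p)
    (hc : linForm ι c ∈ p) (i : Fin 2) : X (ι i) ∈ p := by
  have hD : (C (a 0 * c 1 - a 1 * c 0)⁻¹ * (C (a 0) * C (c 1) - C (a 1) * C (c 0)) :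
      BiRing k) = 1 := by
    rw [← C_mul, ← C_mul, ← C_sub, ← C_mul, inv_mul_cancel₀ h, C_1]
  have key : X (ι i) = C (a 0 * c 1 - a 1 * c 0)⁻¹ * C (a i) * linForm ι c
      - C (a 0 * c 1 - a 1 * c 0)⁻¹ * C (c i) * linForm ι a := by
    fin_cases i <;> simp only [linForm, Fin.zero_eta, Fin.mk_one]
    · linear_combination -X (ι 0) * hD
    · linear_combination -X (ι 1) * hD
  rw [key]
  exact sub_mem (Ideal.mul_mem_left _ _ hc) (Ideal.mul_mem_left _ _ ha)

/-- The substitution replacing both pairs of variables by linear combinations of themselves. -/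
noncomputable def linSubst (M N : Matrix (Fin 2) (Fin 2) k) : BiRing k →ₐ[k] BiRing k :=
  aeval (Sum.elim (fun i => ∑ j, C (M i j) * X (Sum.inl j))
    (fun i => ∑ j, C (N i j) * X (Sum.inr j)))

theorem linSubst_comp (M N M' N' : Matrix (Fin 2) (Fin 2) k) :
    (linSubst M N).comp (linSubst M' N') = linSubst (M' * M) (N' * N) := by
  ext1 v
  rcases v with i | i <;>
  · simp [linSubst, Matrix.mul_apply, Fin.sum_univ_two, algHom_C, algebraMap_eq]
    ring

theorem linSubst_one : linSubst (1 : Matrix (Fin 2) (Fin 2) k) 1 = AlgHom.id k (BiRing k) := by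
  ext1 v
  rcases v with i | i <;> fin_cases i <;> simp [linSubst]

/-- The linear change of coordinates given by two invertible matrices. -/
noncomputable def linSubstEquiv {M N : Matrix (Fin 2) (Fin 2) k} (hM : IsUnit M.det) (hN : IsUnit N.det) :
    BiRing k ≃ₐ[k] BiRing k :=
  AlgEquiv.ofAlgHom (linSubst M N) (linSubst M⁻¹ N⁻¹)
    (by rw [linSubst_comp, Matrix.nonsing_inv_mul _ hM, Matrix.nonsing_inv_mul _ hN, linSubst_one])
    (by rw [linSubst_comp, Matrix.mul_nonsing_inv _ hM, Matrix.mul_nonsing_inv _ hN, linSubst_one])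

theorem linSubst_X_inl (M N : Matrix (Fin 2) (Fin 2) k) (i : Fin 2) :
    linSubst M N (X (Sum.inl i)) = linForm Sum.inl ![-M i 1, M i 0] := by
  simp [linSubst, linForm]

theorem linSubst_X_inr (M N : Matrix (Fin 2) (Fin 2) k) (i : Fin 2) :
    linSubst M N (X (Sum.inr i)) = linForm Sum.inr ![-N i 1, N i 0] := by
  simp [linSubst, linForm]

theorem mem_vecIdeal_pow_of_linForm_mul_mem {a b c : Fin 2 → k} (hb : b ≠ 0)
    (hc : a 0 * c 1 - a 1 * c 0 ≠ 0) {n : ℕ} {F : BiRing k}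
    (h : linForm Sum.inl c * F ∈ vecIdeal a b ^ n) : F ∈ vecIdeal a b ^ n := by
  -- An auxiliary vector completing `b` to a basis, so that the change of coordinates is invertible.
  obtain ⟨d, hd⟩ : ∃ d : Fin 2 → k, b 0 * d 1 - b 1 * d 0 ≠ 0 := by
    by_cases h0 : b 0 = 0
    · refine ⟨![1, 0], ?_⟩
      have : b 1 ≠ 0 := fun h1 => hb (by ext i; fin_cases i <;> assumption)
      simpa using this
    · exact ⟨![0, 1], by simpa using h0⟩
  let M : Matrix (Fin 2) (Fin 2) k := !![a 1, -a 0; c 1, -c 0]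
  let N : Matrix (Fin 2) (Fin 2) k := !![b 1, -b 0; d 1, -d 0]
  have hM : IsUnit M.det := by
    rw [Matrix.det_fin_two_of, isUnit_iff_ne_zero]; convert hc using 1; ring
  have hN : IsUnit N.det := by
    rw [Matrix.det_fin_two_of, isUnit_iff_ne_zero]; convert hd using 1; ring
  let e := (linSubstEquiv hM hN).toRingEquiv
  have hvec (v : Fin 2 → k) : ![v 0, v 1] = v := by ext i; fin_cases i <;> rfl
  have e0 : e (X (Sum.inl 0)) = linForm Sum.inl a :=
    (linSubst_X_inl M N 0).trans (by simp [M, hvec])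
  have e1 : e (X (Sum.inl 1)) = linForm Sum.inl c :=
    (linSubst_X_inl M N 1).trans (by simp [M, hvec])
  have e2 : e (X (Sum.inr 0)) = linForm Sum.inr b :=
    (linSubst_X_inr M N 0).trans (by simp [N, hvec])
  have hmap : vecIdeal a b ^ n =
      ((Ideal.span {X (Sum.inl 0), X (Sum.inr 0)} : Ideal (BiRing k)) ^ n).comap e.symm := by
    rw [Ideal.comap_symm, Ideal.map_pow, Ideal.map_span, Set.image_pair, e0, e2]
    rfl
  rw [hmap, Ideal.mem_comap] at h ⊢
  rw [map_mul, ← e1, RingEquiv.symm_apply_apply] at h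
  exact mem_span_X_pair_pow_of_X_mul_mem (by simp) (by simp) (by simp) h

theorem exists_forall_not_proportional [Infinite k] {ι : Type*} (s : Finset ι)
    (v : ι → Fin 2 → k) (hv : ∀ i ∈ s, v i ≠ 0) :
    ∃ c : Fin 2 → k, ∀ i ∈ s, v i 0 * c 1 - v i 1 * c 0 ≠ 0 := by
  classical
  -- The vector `(1, t)` avoids every finite slope. When `v i 0 = 0` the quotient is a junk value,
  -- and `v i` is never proportional to `(1, t)`.
  obtain ⟨t, ht⟩ := Infinite.exists_notMem_finset (s.image fun i => v i 1 / v i 0)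
  refine ⟨![1, t], fun i hi h => ?_⟩
  simp only [Matrix.cons_val_one, Matrix.cons_val_zero, mul_one] at h
  by_cases h0 : v i 0 = 0
  · refine hv i hi ?_
    ext j
    fin_cases j
    · exact h0
    · simpa [h0] using h
  · refine ht (Finset.mem_image.2 ⟨i, hi, ?_⟩)
    field_simp
    linear_combination -h

theorem vecIdeal_le_ker_aeval {B : Type*} [CommRing B] [Algebra k B] (a b : Fin 2 → k) (s t : B) :
    vecIdeal a b ≤ RingHom.ker (aeval (Sum.elim (fun i => a i • s) (fun i => b i • t)) :
      BiRing k →ₐ[k] B) := by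
  refine Ideal.span_le.2 ?_
  rintro F (rfl | rfl) <;>
  · simp [RingHom.mem_ker, Algebra.smul_def, algHom_C]
    ring

end PointIdeal

/-! ### The cone over a point of Z and the height of its vertex -/

namespace FatPoints

open MvPolynomial

variable {k : Type*} [Field k] (Z : FatPoints k)

theorem mem_ideal_iff {F : BiRing k} : F ∈ Z.ideal ↔ ∀ P ∈ Z.support, F ∈ pointIdeal P ^ Z P := by
  simp [FatPoints.ideal]

theorem ideal_le_pointIdeal {P : ProjLine k × ProjLine k} (hP : P ∈ Z.support) :
    Z.ideal ≤ pointIdeal P := fun _ hF =>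
  Ideal.pow_le_self (Finsupp.mem_support_iff.1 hP) (Z.mem_ideal_iff.1 hF P hP)

theorem exists_pointIdeal_le {p : Ideal (BiRing k)} (hp : p.IsPrime) (h : Z.ideal ≤ p) :
    ∃ P ∈ Z.support, pointIdeal P ≤ p := by
  rw [FatPoints.ideal, ← Finset.inf_eq_iInf, hp.inf_le'] at h
  obtain ⟨P, hP, hle⟩ := h
  exact ⟨P, hP, hp.le_of_pow_le hle⟩

/-- Evaluation of the coordinate ring of `Z` along the cone `(s a, t b)` over a point of `Z`. -/
noncomputable def coneEval {P : ProjLine k × ProjLine k} (hP : P ∈ Z.support) {B : Type*} [CommRing B]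
    [Algebra k B] (s t : B) : BiRing k ⧸ Z.ideal →ₐ[k] B :=
  Ideal.Quotient.liftₐ Z.ideal
    (aeval (Sum.elim (fun i => P.1.rep i • s) (fun i => P.2.rep i • t))) fun _ hF =>
      vecIdeal_le_ker_aeval P.1.rep P.2.rep s t (Z.ideal_le_pointIdeal hP hF)

theorem coneEval_mk_X_inl {P : ProjLine k × ProjLine k} (hP : P ∈ Z.support) {B : Type*}
    [CommRing B] [Algebra k B] (s t : B) (i : Fin 2) :
    Z.coneEval hP s t (Ideal.Quotient.mk _ (X (Sum.inl i))) = P.1.rep i • s := by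
  exact aeval_X _ _

theorem coneEval_mk_X_inr {P : ProjLine k × ProjLine k} (hP : P ∈ Z.support) {B : Type*}
    [CommRing B] [Algebra k B] (s t : B) (i : Fin 2) :
    Z.coneEval hP s t (Ideal.Quotient.mk _ (X (Sum.inr i))) = P.2.rep i • t := by
  exact aeval_X _ _

theorem comp_coneEval {P : ProjLine k × ProjLine k} (hP : P ∈ Z.support) {B B' : Type*}
    [CommRing B] [Algebra k B] [CommRing B'] [Algebra k B'] (s t : B) (g : B →ₐ[k] B') :
    g.comp (Z.coneEval hP s t) = Z.coneEval hP (g s) (g t) := by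
  apply Ideal.Quotient.algHom_ext
  ext v
  rcases v with i | i
  · exact (congrArg g (Z.coneEval_mk_X_inl hP s t i)).trans
      ((map_smul g _ _).trans (Z.coneEval_mk_X_inl hP (g s) (g t) i).symm)
  · exact (congrArg g (Z.coneEval_mk_X_inr hP s t i)).trans
      ((map_smul g _ _).trans (Z.coneEval_mk_X_inr hP (g s) (g t) i).symm)

theorem ker_coneEval_le {P : ProjLine k × ProjLine k} (hP : P ∈ Z.support) {B B' : Type*}
    [CommRing B] [Algebra k B] [CommRing B'] [Algebra k B'] (s t : B) (g : B →ₐ[k] B') :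
    RingHom.ker (Z.coneEval hP s t) ≤ RingHom.ker (Z.coneEval hP (g s) (g t)) := by
  intro x hx
  rw [RingHom.mem_ker] at hx ⊢
  rw [← comp_coneEval, AlgHom.comp_apply, hx, map_zero]

/-- The ideal of the vertex of the cone is generated by the variables. -/
theorem ker_coneEval_zero_le {P : ProjLine k × ProjLine k} (hP : P ∈ Z.support)
    {p : Ideal (BiRing k ⧸ Z.ideal)} (h : ∀ v, Ideal.Quotient.mk _ (X v) ∈ p) :
    RingHom.ker (Z.coneEval hP (0 : k) 0) ≤ p := by
  intro x hx
  obtain ⟨F, rfl⟩ := Ideal.Quotient.mk_surjective x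
  have h0 : constantCoeff F = 0 := by
    rw [← hx]
    have : (Sum.elim (fun i => P.1.rep i • (0 : k)) fun i => P.2.rep i • (0 : k)) = 0 := by
      ext v; rcases v with i | i <;> simp
    change _ = aeval _ F
    rw [this, aeval_zero]
    rfl
  have hF : F ∈ idealOfVars (Fin 2 ⊕ Fin 2) k := by
    rw [← pow_one (idealOfVars _ _), mem_pow_idealOfVars_iff']
    intro d hd
    rw [Nat.lt_one_iff, Finsupp.degree_eq_zero_iff] at hd
    rw [hd]
    exact h0
  have : idealOfVars (Fin 2 ⊕ Fin 2) k ≤ p.comap (Ideal.Quotient.mk _) :=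
    Ideal.span_le.2 (by rintro _ ⟨v, rfl⟩; exact h v)
  exact this hF

theorem isMaximal_ker_coneEval_zero {P : ProjLine k × ProjLine k} (hP : P ∈ Z.support) :
    (RingHom.ker (Z.coneEval hP (0 : k) 0)).IsMaximal :=
  RingHom.ker_isMaximal_of_surjective _ fun c => ⟨algebraMap k _ c, AlgHom.commutes _ c⟩

/-- Specializing the cone parameters `(s, t)` to `(0, t)` and then to `(0, 0)` gives a chain of
three primes, strict because each point has a nonzero coordinate in both factors. -/
theorem two_le_height_ker_coneEval_zero {P : ProjLine k × ProjLine k} (hP : P ∈ Z.support) :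
    2 ≤ (RingHom.ker (Z.coneEval hP (0 : k) 0)).height := by
  obtain ⟨i, hi⟩ := Function.ne_iff.1 P.1.rep_nonzero
  obtain ⟨j, hj⟩ := Function.ne_iff.1 P.2.rep_nonzero
  have h01 : RingHom.ker (Z.coneEval hP (X 0 : MvPolynomial (Fin 2) k) (X 1)) <
      RingHom.ker (Z.coneEval hP (0 : MvPolynomial (Fin 2) k) (X 1)) := by
    refine lt_of_le_of_ne ?_ fun h => ?_
    · simpa using Z.ker_coneEval_le hP (X 0 : MvPolynomial (Fin 2) k) (X 1)
        (aeval ![0, X 1] : _ →ₐ[k] MvPolynomial (Fin 2) k)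
    · have hx : Ideal.Quotient.mk _ (X (Sum.inl i)) ∈
          RingHom.ker (Z.coneEval hP (0 : MvPolynomial (Fin 2) k) (X 1)) := by
        rw [RingHom.mem_ker, coneEval_mk_X_inl, smul_zero]
      rw [← h, RingHom.mem_ker, coneEval_mk_X_inl] at hx
      exact (smul_ne_zero hi (X_ne_zero _)) hx
  have h12 : RingHom.ker (Z.coneEval hP (0 : MvPolynomial (Fin 2) k) (X 1)) <
      RingHom.ker (Z.coneEval hP (0 : k) 0) := by
    refine lt_of_le_of_ne ?_ fun h => ?_
    · simpa using Z.ker_coneEval_le hP (0 : MvPolynomial (Fin 2) k) (X 1)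
        (aeval 0 : _ →ₐ[k] k)
    · have hx : Ideal.Quotient.mk _ (X (Sum.inr j)) ∈
          RingHom.ker (Z.coneEval hP (0 : k) 0) := by
        rw [RingHom.mem_ker, coneEval_mk_X_inr, smul_zero]
      rw [← h, RingHom.mem_ker, coneEval_mk_X_inr] at hx
      exact (smul_ne_zero hj (X_ne_zero _)) hx
  have := RingHom.ker_isPrime (Z.coneEval hP (X 0 : MvPolynomial (Fin 2) k) (X 1))
  have := RingHom.ker_isPrime (Z.coneEval hP (0 : MvPolynomial (Fin 2) k) (X 1))
  have := RingHom.ker_isPrime (Z.coneEval hP (0 : k) 0)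
  calc (2 : ℕ∞) = 0 + 1 + 1 := by norm_num
    _ ≤ (RingHom.ker (Z.coneEval hP (X 0 : MvPolynomial (Fin 2) k) (X 1))).height + 1 + 1 := by
      gcongr; exact bot_le
    _ ≤ (RingHom.ker (Z.coneEval hP (0 : MvPolynomial (Fin 2) k) (X 1))).height + 1 := by
      gcongr; exact Ideal.height_add_one_le_of_lt_of_isPrime h01
    _ ≤ _ := Ideal.height_add_one_le_of_lt_of_isPrime h12

end FatPoints

/-! ### Bidegrees and the main theorem -/

theorem isBiform_linForm_inl {k : Type*} [Field k] (c : Fin 2 → k) :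
    IsBiform (linForm Sum.inl c) (1, 0) := by
  have h (i : Fin 2) (r : k) : IsBiform (MvPolynomial.C r * MvPolynomial.X (Sum.inl i)) (1, 0) :=
    (MvPolynomial.isWeightedHomogeneous_X k biWeight (Sum.inl i)).C_mul r
  exact (MvPolynomial.weightedHomogeneousSubmodule k biWeight (1, 0)).sub_mem (h 0 _) (h 1 _)

theorem isBiform_linForm_inr {k : Type*} [Field k] (c : Fin 2 → k) :
    IsBiform (linForm Sum.inr c) (0, 1) := by
  have h (i : Fin 2) (r : k) : IsBiform (MvPolynomial.C r * MvPolynomial.X (Sum.inr i)) (0, 1) :=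
    (MvPolynomial.isWeightedHomogeneous_X k biWeight (Sum.inr i)).C_mul r
  exact (MvPolynomial.weightedHomogeneousSubmodule k biWeight (0, 1)).sub_mem (h 0 _) (h 1 _)

theorem theorem4p5 {k : Type*} [Field k] [IsAlgClosed k] (Z : FatPoints k) (hZ : Z ≠ 0)
    (hACM : Z.IsACM) :
    ∃ L₁ L₂ : BiRing k, IsBiform L₁ (1, 0) ∧ IsBiform L₂ (0, 1) ∧
      RingTheory.Sequence.IsRegular (BiRing k ⧸ Z.ideal)
        [Ideal.Quotient.mk Z.ideal L₁, Ideal.Quotient.mk Z.ideal L₂] := by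
  have := IsAlgClosed.instInfinite (K := k)
  obtain ⟨c, hc⟩ := exists_forall_not_proportional Z.support (fun P => P.1.rep)
    fun P _ => P.1.rep_nonzero
  obtain ⟨d, hd⟩ := exists_forall_not_proportional Z.support (fun P => P.2.rep)
    fun P _ => P.2.rep_nonzero
  obtain ⟨P, hP⟩ := Finsupp.support_nonempty_iff.2 hZ
  have := Z.isMaximal_ker_coneEval_zero hP
  have := hACM.1
  have hdepth : 2 ≤ localDepth
      (Localization.AtPrime (RingHom.ker (Z.coneEval hP (0 : k) 0))) := by
    have h := hACM.2 (RingHom.ker (Z.coneEval hP (0 : k) 0))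
    rw [IsLocalization.AtPrime.ringKrullDim_eq_height
      (RingHom.ker (Z.coneEval hP (0 : k) 0))] at h
    rw [WithBot.coe_inj.1 h]
    exact Z.two_le_height_ker_coneEval_zero hP
  have hL₁ : ∀ x, Ideal.Quotient.mk Z.ideal (linForm Sum.inl c) * x = 0 → x = 0 := by
    intro x hx
    obtain ⟨F, rfl⟩ := Ideal.Quotient.mk_surjective x
    rw [← map_mul, Ideal.Quotient.eq_zero_iff_mem, Z.mem_ideal_iff] at hx
    rw [Ideal.Quotient.eq_zero_iff_mem, Z.mem_ideal_iff]
    exact fun Q hQ =>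
      mem_vecIdeal_pow_of_linForm_mul_mem Q.2.rep_nonzero (hc Q hQ) (hx Q hQ)
  refine ⟨linForm Sum.inl c, linForm Sum.inr d, isBiform_linForm_inl c, isBiform_linForm_inr d,
    ⟨(isWeaklyRegular_pair_iff _ _ _).2 ⟨hL₁, fun x hx =>
      mem_span_of_mul_mem_span_of_primes (RingHom.ker (Z.coneEval hP (0 : k) 0))
        (IsNoetherian.noetherian _) hdepth hL₁ (fun p hp h1 h2 => ?_) hx,
      IsWeaklyRegular.nil _ _⟩, fun htop => ?_⟩⟩
  -- The point `Q` depends on the prime, so `c` and `d` had to avoid all the points at once.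
  · obtain ⟨Q, hQ, hle⟩ := Z.exists_pointIdeal_le (hp.comap (Ideal.Quotient.mk Z.ideal)) <| by
      conv_lhs => rw [← Ideal.mk_ker (I := Z.ideal)]
      exact Ideal.comap_mono bot_le
    refine Z.ker_coneEval_zero_le hP fun v => ?_
    rcases v with i | i
    · exact X_mem_of_linForm_mem (hc Q hQ) (hle (Ideal.subset_span (Set.mem_insert _ _))) h1 i
    · exact X_mem_of_linForm_mem (hd Q hQ)
        (hle (Ideal.subset_span (Set.mem_insert_of_mem _ rfl))) h2 i
  -- Both forms vanish at the vertex, so they generate a proper ideal.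
  · refine Ideal.IsPrime.ne_top (I := RingHom.ker (Z.coneEval hP (0 : k) 0)) inferInstance
      (top_le_iff.1 ?_)
    rw [htop, smul_eq_mul, Ideal.mul_top, Ideal.ofList, Ideal.span_le]
    intro x hx
    rcases List.mem_pair.1 hx with rfl | rfl <;>
    simp [FatPoints.coneEval, linForm, RingHom.mem_ker]
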